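/- Let $F=C_1\wedge\dots\wedge C_m$ be a CNF formula in $n$ Boolean variables $x_1,\dots,x_n$ (bit $1$ = true) with at least one satisfying assignment, and let $r_j$ be the number of occurrences of $x_j$ in $F$. Use the following qubits: for each $j$ a group $x_j^0,x_j^1,\dots$ of $\max(1,r_j)$ qubits, distinct occurrences of $x_j$ being assigned (in any way) distinct qubits of its group; one qubit per clause; one formula qubit; one control qubit $s$. Initially each variable group is in the state $\frac1{\sqrt2}(|0\cdots0\rangle+|1\cdots1\rangle)$ (that is, $|+\rangle$ for a single qubit), the clause and formula qubits are in $|0\rangle$, and $s$ is in $|1\rangle$. Iteration $t=1,2,\dots$ of the parallel fixed-point search algorithm with angle $\phi_t\in\mathbb R$ does the following. (1) Controlled oracle. For each clause apply its clause circuit: $X$ on the qubits of its positive literals, $X$ on its clause qubit, then $X$ on the clause qubit controlled by all its literal qubits. Apply $R_y(\phi_t)=e^{-i\phi_tY/2}$ to $s$, and $X$ on the formula qubit controlled by all clause qubits. Apply $Z$ on the formula qubit controlled by $s$. Then undo the first part: apply the controlled $X$ on the formula qubit, the inverse clause circuits, and $R_y(-\phi_t)$ on $s$. (2) Controlled diffuser.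 In each group apply CNOTs from $x_j^0$ to all its other qubits; apply $H$ and then $X$ to every $x_j^0$; apply the multi-controlled $Z$ on all $x_j^0$ and $s$; apply $X$ and then $H$ to every $x_j^0$; apply the CNOTs in each group again. (3) Measure $s$ in the computational basis. If the result is $0$, stop and output the current state; if it is $1$, go on to iteration $t+1$. Suppose that $$\cos\phi_t=\frac{1-\sin(\pi/(2t))}{1+\sin(\pi/(2t))}\qquad\text{for all } t\ge 2,$$ while $\phi_1$ is arbitrary (in particular, $\phi_1$ may follow the same rule). Then the probability that the algorithm stops within the first $T$ iterations tends to $1$ as $T\to\infty$; and whenever the algorithm stops in an iteration in which stopping has positive probability, the output state is, up to a global phase, the uniform superposition of the satisfying assignments, $$\frac1{\sqrt M}\sum_{a\ \text{satisfies}\ F}|a\rangle ,$$ where $M$ is the number of satisfying assignments and $|a\rangle$ is the basis state in which all qubits of the group of $x_j$ carry $a_j$ and the clause, formula and control qubits carry $0$. -/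

import Mathlib

open Filter Topology

/-! ### Formulas in conjunctive normal form

Bits are elements of `Fin 2`; the bit `1` is the truth value "true". -/

/-- A literal over the variables `x_j`, `j : Fin n`: the variable itself if `pos = true`, its
negation otherwise. -/
structure Literal (n : ℕ) where
  var : Fin n
  pos : Bool

/-- The literal `l` is true under the assignment `a`. -/
abbrev Literal.Holds {n : ℕ} (l : Literal n) (a : Fin n → Fin 2) : Prop :=
  a l.var = if l.pos = true then 1 else 0

/-- A CNF formula: the conjunction over `i : Fin m` of the clauses
`lit i 0 ∨ ... ∨ lit i (width i - 1)`. -/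
structure CNF (n : ℕ) where
  m : ℕ
  width : Fin m → ℕ
  lit : (i : Fin m) → Fin (width i) → Literal n

namespace CNF

variable {n : ℕ} (F : CNF n)

/-- The assignment `a` satisfies the formula. -/
abbrev Sat (a : Fin n → Fin 2) : Prop := ∀ i, ∃ p, (F.lit i p).Holds a

/-- The satisfying assignments. -/
def solutions : Finset (Fin n → Fin 2) := Finset.univ.filter fun a => F.Sat a

/-- The occurrences of the variable `x_j` in the formula: the positions (clause, place in the
clause) that carry `x_j` or its negation. -/
abbrev Occ (j : Fin n) : Type :=
  {o : (i : Fin F.m) × Fin (F.width i) // (F.lit o.1 o.2).var = j}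

/-- The number `r_j` of occurrences of the variable `x_j`. -/
def occCount (j : Fin n) : ℕ := Fintype.card (F.Occ j)

/-- The number of qubits in the variable qubit group of `x_j`: one per occurrence (the original
qubit and `r_j - 1` auxiliary ones), and a single one if `x_j` does not occur. -/
def groupSize (j : Fin n) : ℕ := max 1 (F.occCount j)

/-- A numbering of the occurrences of each variable; it decides which qubit of the group of
`x_j` is used by which occurrence of `x_j`. -/
abbrev Numbering : Type := ∀ j, F.Occ j ≃ Fin (F.occCount j)

/-- The qubits of the algorithm: the qubits `x_j^i` of the variable groups, one qubit for the value
of each clause, the formula qubit and the control qubit. -/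
inductive Wire {n : ℕ} (F : CNF n) : Type
  | var (j : Fin n) (i : Fin (F.groupSize j)) : Wire F
  | clause (i : Fin F.m) : Wire F
  | formula : Wire F
  | control : Wire F
  deriving DecidableEq, Fintype

/-- The qubit `x_j^0`. -/
def zeroth (j : Fin n) : F.Wire := .var j ⟨0, lt_of_lt_of_le Nat.zero_lt_one (le_max_left _ _)⟩

/-- The variable qubit on which the clause circuit of clause `i` reads its `p`-th literal. -/
def litWire {F : CNF n} (e : F.Numbering) (i : Fin F.m) (p : Fin (F.width i)) : F.Wire :=
  .var (F.lit i p).var (Fin.castLE (le_max_right _ _) (e (F.lit i p).var ⟨⟨i, p⟩, rfl⟩))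

end CNF

/-! ### Quantum circuits -/

/-- Vectors in the state space of the qubits in `W`, given by their amplitudes in the
computational basis. -/
abbrev QState (W : Type) [Fintype W] [DecidableEq W] : Type := EuclideanSpace ℂ (W → Fin 2)

/-- The single-qubit gate `mat` on the qubit `target`, controlled by the qubits in `controls`
(all of them have to be `1`). -/
structure Gate (W : Type) where
  controls : List W
  target : W
  mat : Matrix (Fin 2) (Fin 2) ℂ

noncomputable section

namespace Gate

variable {W : Type} [Fintype W] [DecidableEq W]

/-- The action of a gate on states. -/
def apply (g : Gate W) (ψ : QState W) : QState W :=
  WithLp.toLp 2 fun b =>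
    if ∀ c ∈ g.controls, b c = 1 then
      ∑ k : Fin 2, g.mat (b g.target) k * ψ (Function.update b g.target k)
    else ψ b

end Gate

/-- Applies the gates of a circuit, the head of the list first. -/
def runCircuit {W : Type} [Fintype W] [DecidableEq W] (c : List (Gate W)) (ψ : QState W) :
    QState W :=
  c.foldl (fun ξ g => g.apply ξ) ψ

/-- The Pauli gate `X`. -/
def matX : Matrix (Fin 2) (Fin 2) ℂ := !![0, 1; 1, 0]

/-- The Pauli gate `Z`. -/
def matZ : Matrix (Fin 2) (Fin 2) ℂ := !![1, 0; 0, -1]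

/-- The Hadamard gate. -/
def matH : Matrix (Fin 2) (Fin 2) ℂ := ((1 / √2 : ℝ) : ℂ) • !![1, 1; 1, -1]

/-- The rotation `exp (-i φ Y / 2)` about the y-axis. -/
def matRy (φ : ℝ) : Matrix (Fin 2) (Fin 2) ℂ :=
  !![(Real.cos (φ / 2) : ℂ), -(Real.sin (φ / 2) : ℂ);
     (Real.sin (φ / 2) : ℂ), (Real.cos (φ / 2) : ℂ)]

/-- The unnormalised projection of `ψ` to the subspace where the qubit `w` has the value `k`. -/
def projectBit {W : Type} [Fintype W] [DecidableEq W] (w : W) (k : Fin 2) (ψ : QState W) :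
    QState W :=
  WithLp.toLp 2 fun b => if b w = k then ψ b else 0

/-- The probability of the outcome `k` when the qubit `w` is measured in the (unit) state `ψ`. -/
def measureProb {W : Type} [Fintype W] [DecidableEq W] (w : W) (k : Fin 2) (ψ : QState W) : ℝ :=
  ‖projectBit w k ψ‖ ^ 2

/-- The state after a measurement of the qubit `w` in the state `ψ` with outcome `k` (of positive
probability). -/
def measurePost {W : Type} [Fintype W] [DecidableEq W] (w : W) (k : Fin 2) (ψ : QState W) :
    QState W :=
  ((‖projectBit w k ψ‖⁻¹ : ℝ) : ℂ) • projectBit w k ψ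

/-! ### The parallel fixed-point search algorithm -/

namespace CNF

variable {n : ℕ} {F : CNF n}

/-- The gates `R` of the clause circuit: `X` at a positive literal, nothing at a negated one. -/
def literalGates (e : F.Numbering) (i : Fin F.m) : List (Gate F.Wire) :=
  ((List.finRange (F.width i)).filter fun p => (F.lit i p).pos).map
    fun p => ⟨[], litWire e i p, matX⟩

/-- The multi-controlled NOT gate of the clause circuit. -/
def clauseNot (e : F.Numbering) (i : Fin F.m) : Gate F.Wire :=
  ⟨(List.finRange (F.width i)).map (litWire e i), .clause i, matX⟩

/-- The circuit of clause `i`, which writes the value of the clause to its clause qubit. -/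
def clauseCircuit (e : F.Numbering) (i : Fin F.m) : List (Gate F.Wire) :=
  literalGates e i ++ [⟨[], .clause i, matX⟩] ++ [clauseNot e i]

/-- The inverse circuit of clause `i`. -/
def clauseInverse (e : F.Numbering) (i : Fin F.m) : List (Gate F.Wire) :=
  [clauseNot e i] ++ literalGates e i ++ [⟨[], .clause i, matX⟩]

/-- The multi-controlled NOT gate that writes the conjunction of the clauses to the formula
qubit. -/
def formulaNot (F : CNF n) : Gate F.Wire :=
  ⟨(List.finRange F.m).map Wire.clause, .formula, matX⟩

/-- The controlled parallel oracle: the module `Ω`, the controlled `Z` gate, the inverse of `Ω`. -/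
def oracle (e : F.Numbering) (φ : ℝ) : List (Gate F.Wire) :=
  ((List.finRange F.m).flatMap (clauseCircuit e) ++ [⟨[], .control, matRy φ⟩] ++ [formulaNot F]) ++
  [⟨[.control], .formula, matZ⟩] ++
  ([formulaNot F] ++ (List.finRange F.m).flatMap (clauseInverse e) ++ [⟨[], .control, matRy (-φ)⟩])

/-- In each variable group, CNOT gates from the zeroth qubit to all the others. They disentangle
the groups, and entangle them again. -/
def groupCNOTs (F : CNF n) : List (Gate F.Wire) :=
  (List.finRange n).flatMap fun j =>
    ((List.finRange (F.groupSize j)).filter fun i => i.val ≠ 0).map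
      fun i => ⟨[F.zeroth j], .var j i, matX⟩

/-- The gate `M` on the zeroth qubit of each variable group. -/
def onZeroths (F : CNF n) (M : Matrix (Fin 2) (Fin 2) ℂ) : List (Gate F.Wire) :=
  (List.finRange n).map fun j => ⟨[], F.zeroth j, M⟩

/-- The controlled diffuser. The multi-controlled `Z` gate on the qubits `x_j^0` and the control
qubit is symmetric in these qubits, so that any of them can be called its target. -/
def diffuser (F : CNF n) : List (Gate F.Wire) :=
  groupCNOTs F ++ onZeroths F matH ++ onZeroths F matX ++
  [⟨(List.finRange n).map F.zeroth, .control, matZ⟩] ++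
  onZeroths F matX ++ onZeroths F matH ++ groupCNOTs F

/-- The initial state: each variable group in the state `(|0...0⟩ + |1...1⟩) / √2` (which is `|+⟩`
for a group of one qubit), clause and formula qubits in `|0⟩`, the control qubit in `|1⟩`. -/
def initState (F : CNF n) : QState F.Wire :=
  WithLp.toLp 2 fun b =>
    (∏ j : Fin n, if ∀ i, b (.var j i) = b (F.zeroth j) then ((1 / √2 : ℝ) : ℂ) else 0) *
      if (∀ i, b (.clause i) = 0) ∧ b .formula = 0 ∧ b .control = 1 then 1 else 0

/-- The state in which an iteration with the angle `φ` that starts from `ψ` measures the control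
qubit. -/
def iterate (e : F.Numbering) (φ : ℝ) (ψ : QState F.Wire) : QState F.Wire :=
  runCircuit (F.diffuser) (runCircuit (oracle e φ) ψ)

/-- The state after `t` iterations if all of them have measured `1`. Iteration `t` (where
`t = 1, 2, ...`) uses the angle `φ t`. -/
def runState (e : F.Numbering) (φ : ℕ → ℝ) : ℕ → QState F.Wire
  | 0 => initState F
  | t + 1 => measurePost .control 1 (iterate e (φ (t + 1)) (runState e φ t))

/-- The probability that the first `t` iterations all measure `1`. -/
def continueProb (e : F.Numbering) (φ : ℕ → ℝ) : ℕ → ℝ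
  | 0 => 1
  | t + 1 => continueProb e φ t *
      measureProb .control 1 (iterate e (φ (t + 1)) (runState e φ t))

/-- The probability that the algorithm stops in iteration `t + 1`: the first `t` iterations measure
`1` and iteration `t + 1` measures `0`. -/
def haltProb (e : F.Numbering) (φ : ℕ → ℝ) (t : ℕ) : ℝ :=
  continueProb e φ t * measureProb .control 0 (iterate e (φ (t + 1)) (runState e φ t))

/-- The output state of the algorithm if it stops in iteration `t + 1`. -/
def outState (e : F.Numbering) (φ : ℕ → ℝ) (t : ℕ) : QState F.Wire :=
  measurePost .control 0 (iterate e (φ (t + 1)) (runState e φ t))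

/-- The computational basis state that encodes the assignment `a` (all qubits of the group of `x_j`
carry `a j`), with all other qubits `0`. -/
def encode (F : CNF n) (a : Fin n → Fin 2) : F.Wire → Fin 2
  | .var j _ => a j
  | .clause _ => 0
  | .formula => 0
  | .control => 0

/-- The uniform superposition of the satisfying assignments (with clause qubits, formula qubit and
control qubit in `|0⟩`). -/
def targetState (F : CNF n) : QState F.Wire :=
  ((1 / √(F.solutions.card : ℝ) : ℝ) : ℂ) •
    ∑ a ∈ F.solutions, EuclideanSpace.single (F.encode a) (1 : ℂ)

end CNF

end

/-! Every continuing iteration keeps the state in a two-parameter family: control qubit `1`, one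
common amplitude x on the M satisfying assignments and one common amplitude y on the K falsifying
ones. On a satisfying assignment the controlled phase sits between `R_y(φ)` and `R_y(-φ)` and turns
control `1` into -sin φ |0⟩ - cos φ |1⟩; on a falsifying one the rotations cancel (`oracle_run`).
The diffuser is the identity at control `0` and the reflection I - 2|+⟩⟨+| at control `1`
(`diffuser_run_zero`, `diffuser_run_one`). Hence the branch that stops is always a multiple of the
uniform superposition of the solutions, which settles the output state.

For the halting probability, drop the normalisations. The squared norm M x² + K y² of the
unnormalised continuing state is then the probability of not having stopped (`continueProb_eq`). The
reflection preserves it, so an iteration with cosine c loses exactly M (1 - c²) x². The mass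
decreases to a limit L. A small x does not prevent loss for long: the reflection feeds y into the
next x, so x² + x'² is at least a constant times the mass (`amplitudeMass_le`). The angle rule gives
1 - c² ≥ 1/t, so if L > 0, any two consecutive steps would lose a constant times 1/t, contradicting
the divergence of the harmonic series (`amplitudeMass_tendsto_zero`). -/

noncomputable section

/-! ### Circuits on basis states -/

section Circuits

variable {W : Type} [Fintype W] [DecidableEq W]

/-- The computational basis state with the bits `b`. -/
def ket (b : W → Fin 2) : QState W := EuclideanSpace.single b (1 : ℂ)

lemma ket_apply (b b' : W → Fin 2) : ket b b' = if b' = b then 1 else 0 := by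
  simp [ket]

/-- A gate as a linear map. -/
def Gate.linearMap (g : Gate W) : QState W →ₗ[ℂ] QState W where
  toFun := g.apply
  map_add' ψ ξ := by
    ext b
    simp only [Gate.apply, PiLp.add_apply]
    split_ifs
    · simp [mul_add]; ring
    · rfl
  map_smul' z ψ := by
    ext b
    simp only [Gate.apply, PiLp.smul_apply, smul_eq_mul, RingHom.id_apply]
    split_ifs
    · simp; ring
    · rfl

/-- A circuit as a linear map. -/
def circuitMap (c : List (Gate W)) : QState W →ₗ[ℂ] QState W :=
  c.foldl (fun T g => g.linearMap ∘ₗ T) LinearMap.id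

/-- The accumulator `T` is arbitrary for the induction; the case of the identity yields the
linearity of `runCircuit`. -/
lemma foldl_linearMap (c : List (Gate W)) (T : QState W →ₗ[ℂ] QState W) (ψ : QState W) :
    c.foldl (fun T g => g.linearMap ∘ₗ T) T ψ = runCircuit c (T ψ) := by
  induction c generalizing T with
  | nil => rfl
  | cons g c ih => rw [List.foldl_cons, ih]; rfl

lemma circuitMap_apply (c : List (Gate W)) (ψ : QState W) : circuitMap c ψ = runCircuit c ψ :=
  foldl_linearMap c _ ψ

lemma runCircuit_nil (ψ : QState W) : runCircuit [] ψ = ψ := rfl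

lemma runCircuit_cons (g : Gate W) (c : List (Gate W)) (ψ : QState W) :
    runCircuit (g :: c) ψ = runCircuit c (g.apply ψ) := rfl

lemma runCircuit_singleton (g : Gate W) (ψ : QState W) : runCircuit [g] ψ = g.apply ψ := rfl

lemma runCircuit_append (c d : List (Gate W)) (ψ : QState W) :
    runCircuit (c ++ d) ψ = runCircuit d (runCircuit c ψ) := List.foldl_append

lemma runCircuit_add (c : List (Gate W)) (ψ ξ : QState W) :
    runCircuit c (ψ + ξ) = runCircuit c ψ + runCircuit c ξ := by
  simp [← circuitMap_apply]

lemma runCircuit_sub (c : List (Gate W)) (ψ ξ : QState W) :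
    runCircuit c (ψ - ξ) = runCircuit c ψ - runCircuit c ξ := by
  simp [← circuitMap_apply]

lemma runCircuit_smul (c : List (Gate W)) (z : ℂ) (ψ : QState W) :
    runCircuit c (z • ψ) = z • runCircuit c ψ := by
  simp [← circuitMap_apply]

lemma runCircuit_sum {ι : Type*} (c : List (Gate W)) (s : Finset ι) (ψ : ι → QState W) :
    runCircuit c (∑ i ∈ s, ψ i) = ∑ i ∈ s, runCircuit c (ψ i) := by
  simp [← circuitMap_apply]

lemma fin_two_flip_flip (k : Fin 2) : 1 - (1 - k) = k := by
  fin_cases k <;> rfl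

/-- The action of the controlled `X` gate on bits. -/
def flipBit (cs : List W) (t : W) (b : W → Fin 2) : W → Fin 2 :=
  if ∀ c ∈ cs, b c = 1 then Function.update b t (1 - b t) else b

lemma flipBit_nil (t : W) (b : W → Fin 2) :
    flipBit [] t b = Function.update b t (1 - b t) := if_pos (by simp)

lemma flipBit_flipBit {cs : List W} {t : W} (h : t ∉ cs) (b : W → Fin 2) :
    flipBit cs t (flipBit cs t b) = b := by
  unfold flipBit
  by_cases hc : ∀ c ∈ cs, b c = 1
  · have : ∀ c ∈ cs, Function.update b t (1 - b t) c = 1 := fun c hcs => by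
      rw [Function.update_of_ne (by rintro rfl; exact h hcs)]; exact hc c hcs
    rw [if_pos hc, if_pos this]
    simp
  · simp [hc]

lemma matX_sum (k : Fin 2) (f : Fin 2 → ℂ) : ∑ l, matX k l * f l = f (1 - k) := by
  fin_cases k <;> simp [matX]

/-- The gate reads the old amplitude at the flipped bits, and flipping is an involution because the
target is not a control. -/
lemma apply_matX_ket {cs : List W} {t : W} (h : t ∉ cs) (b : W → Fin 2) :
    Gate.apply ⟨cs, t, matX⟩ (ket b) = ket (flipBit cs t b) := by
  ext b'
  have h1 : Gate.apply ⟨cs, t, matX⟩ (ket b) b' = ket b (flipBit cs t b') := by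
    simp only [Gate.apply, flipBit]
    split_ifs
    · rw [matX_sum _ fun k => ket b (Function.update b' t k)]
    · rfl
  rw [h1, ket_apply, ket_apply]
  congr 1
  apply propext
  constructor
  · rintro rfl; exact (flipBit_flipBit h b').symm
  · rintro rfl; exact flipBit_flipBit h b

/-- Controlled `X` gates with distinct targets none of which is a control act in parallel. -/
lemma runCircuit_parallel_flips (gs : List (Gate W)) (hX : ∀ g ∈ gs, g.mat = matX)
    (hnd : (gs.map Gate.target).Nodup)
    (hct : ∀ g ∈ gs, ∀ h ∈ gs, ∀ c ∈ g.controls, c ≠ h.target) (b : W → Fin 2) :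
    runCircuit gs (ket b) = ket fun w =>
      if ∃ g ∈ gs, g.target = w ∧ ∀ c ∈ g.controls, b c = 1 then 1 - b w else b w := by
  induction gs generalizing b with
  | nil => simp [runCircuit_nil]
  | cons g gs ih =>
    obtain ⟨cs, t, M⟩ := g
    obtain rfl : M = matX := hX _ List.mem_cons_self
    rw [List.map_cons, List.nodup_cons] at hnd
    rw [runCircuit_cons,
      apply_matX_ket fun ht => hct _ List.mem_cons_self _ List.mem_cons_self t ht rfl,
      ih (fun g hg => hX g (List.mem_cons_of_mem _ hg)) hnd.2
        fun g hg h hh => hct g (List.mem_cons_of_mem _ hg) h (List.mem_cons_of_mem _ hh)]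
    congr 1
    -- The first gate changes only its own target, which no later gate reads as a control.
    have hf : ∀ g ∈ gs, ∀ c ∈ g.controls, flipBit cs t b c = b c := fun g hg c hc => by
      have := hct g (List.mem_cons_of_mem _ hg) _ List.mem_cons_self c hc
      unfold flipBit
      split_ifs
      · rw [Function.update_of_ne this]
      · rfl
    have hiff : ∀ w, (∃ g ∈ gs, g.target = w ∧ ∀ c ∈ g.controls, flipBit cs t b c = 1) ↔
        ∃ g ∈ gs, g.target = w ∧ ∀ c ∈ g.controls, b c = 1 := fun w => by
      refine exists_congr fun g => and_congr_right fun hg => and_congr_right fun _ =>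
        forall₂_congr fun c hc => ?_
      rw [hf g hg c hc]
    funext w
    simp only [hiff, List.exists_mem_cons_iff]
    by_cases hw : t = w
    · subst hw
      have hno : ¬ ∃ g ∈ gs, g.target = t ∧ ∀ c ∈ g.controls, b c = 1 := by
        rintro ⟨g, hg, hgt, -⟩
        exact hnd.1 (List.mem_map.2 ⟨g, hg, hgt⟩)
      simp only [hno, or_false, if_false, true_and, flipBit]
      split_ifs <;> simp
    · have : flipBit cs t b w = b w := by
        unfold flipBit
        split_ifs
        · rw [Function.update_of_ne (Ne.symm hw)]
        · rfl
      simp [hw, this]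

lemma apply_single_ket (t : W) (M : Matrix (Fin 2) (Fin 2) ℂ) (b : W → Fin 2) :
    Gate.apply ⟨[], t, M⟩ (ket b) = ∑ k, M k (b t) • ket (Function.update b t k) := by
  ext b'
  have key : ∀ k l : Fin 2, (Function.update b' t k = b ∧ b' t = l) ↔
      (b' = Function.update b t l ∧ b t = k) := by
    intro k l
    constructor
    · rintro ⟨rfl, rfl⟩; simp
    · rintro ⟨rfl, rfl⟩; simp
  by_cases h : ∃ k, Function.update b' t k = b
  · obtain ⟨k, rfl⟩ := h
    simp only [Gate.apply, ket_apply, List.not_mem_nil, IsEmpty.forall_iff, implies_true, if_true,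
      Function.update_idem, Function.update_self, Fin.sum_univ_two, PiLp.add_apply,
      PiLp.smul_apply, smul_eq_mul]
    have h1 : ∀ l, (b' = Function.update b' t l) ↔ l = b' t := fun l => by
      constructor
      · intro h; rw [h]; simp
      · rintro rfl; simp
    have h2 : ∀ l, (Function.update b' t l = Function.update b' t k) ↔ l = k :=
      fun l => (Function.update_injective b' t).eq_iff
    simp only [h1, h2]
    generalize b' t = l
    fin_cases k <;> fin_cases l <;> simp
  · have h2 : ∀ k, ¬ b' = Function.update b t k := fun k hk => h ⟨b t, by rw [hk]; simp⟩
    push Not at h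
    simp [Gate.apply, ket_apply, h, h2]

lemma apply_matZ_ket (cs : List W) (t : W) (b : W → Fin 2) :
    Gate.apply ⟨cs, t, matZ⟩ (ket b) =
      (if (∀ c ∈ cs, b c = 1) ∧ b t = 1 then (-1 : ℂ) else 1) • ket b := by
  have hZ : ∀ b' : W → Fin 2, ∑ k, matZ (b' t) k * ket b (Function.update b' t k) =
      (if b' t = 1 then -1 else 1) * ket b b' := by
    intro b'
    have : ∀ k (f : Fin 2 → ℂ), ∑ l, matZ k l * f l = (if k = 1 then -1 else 1) * f k := by
      intro k f; fin_cases k <;> simp [matZ]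
    rw [this _ fun k => ket b (Function.update b' t k)]
    simp
  ext b'
  simp only [Gate.apply, hZ, PiLp.smul_apply, smul_eq_mul]
  rw [ket_apply]
  by_cases h : b' = b
  · subst h
    by_cases h1 : ∀ c ∈ cs, b' c = 1
    · rw [if_pos h1, if_congr (and_iff_right h1) rfl rfl]
    · rw [if_neg h1, if_pos rfl, if_neg fun h => h1 h.1, one_mul]
  · simp [h]

end Circuits

end

noncomputable section

namespace CNF

variable {n : ℕ} {F : CNF n}

/-! ### The controlled oracle -/

/-- Distinct occurrences use distinct qubits, so different clause circuits never touch the same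
variable qubit. This is what makes the oracle parallel. -/
lemma litWire_injective (e : F.Numbering) {i i' : Fin F.m} {p : Fin (F.width i)}
    {p' : Fin (F.width i')} (h : litWire e i p = litWire e i' p') :
    (⟨i, p⟩ : (i : Fin F.m) × Fin (F.width i)) = ⟨i', p'⟩ := by
  -- Stated for free `j`, `j'` so that the equality of variables can be substituted in the dependent
  -- types.
  have key : ∀ (j j' : Fin n) (o : F.Occ j) (o' : F.Occ j'),
      (Wire.var j (Fin.castLE (le_max_right _ _) (e j o)) : F.Wire) =
        Wire.var j' (Fin.castLE (le_max_right _ _) (e j' o')) → o.1 = o'.1 := by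
    intro j j' o o' h
    have hj : j = j' := by injection h
    subst hj
    have := eq_of_heq (Wire.var.inj h).2
    rw [(e j).injective (Fin.castLE_injective _ this)]
  exact key _ _ ⟨⟨i, p⟩, rfl⟩ ⟨⟨i', p'⟩, rfl⟩ h

/-- The wires of the variable groups that the clause circuits of the clauses in `P` flip. -/
abbrev Flipped (e : F.Numbering) (P : Finset (Fin F.m)) (w : F.Wire) : Prop :=
  ∃ i ∈ P, ∃ p, (F.lit i p).pos = true ∧ litWire e i p = w

/-- The bits after the clause circuits of the clauses in `P`, for the assignment `a`, the value
`f` of the formula qubit and the value `k` of the control qubit. -/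
def oracleBits (e : F.Numbering) (P : Finset (Fin F.m)) (a : Fin n → Fin 2) (f k : Fin 2) :
    F.Wire → Fin 2
  | .var j q => if Flipped e P (.var j q) then 1 - a j else a j
  | .clause i => if i ∈ P ∧ ∃ p, (F.lit i p).Holds a then 1 else 0
  | .formula => f
  | .control => k

variable (e : F.Numbering) {P : Finset (Fin F.m)} {i : Fin F.m} (a : Fin n → Fin 2) (f k : Fin 2)

lemma flipped_litWire_iff (p : Fin (F.width i)) :
    Flipped e P (litWire e i p) ↔ i ∈ P ∧ (F.lit i p).pos = true := by
  constructor
  · rintro ⟨i', hi', p', hp', h⟩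
    obtain ⟨rfl, h⟩ := Sigma.mk.inj (litWire_injective e h)
    cases eq_of_heq h
    exact ⟨hi', hp'⟩
  · rintro ⟨hi, hp⟩
    exact ⟨i, hi, p, hp, rfl⟩

/-- After the flips of the positive literals, a qubit carries `1` exactly when its literal is false;
the clause's controlled NOT therefore fires exactly when the whole clause fails. -/
lemma oracleBits_litWire (hi : i ∈ P) (p : Fin (F.width i)) :
    oracleBits e P a f k (litWire e i p) = 1 ↔ ¬ (F.lit i p).Holds a := by
  have h := flipped_litWire_iff e (P := P) p
  obtain ⟨q, hq⟩ : ∃ q, litWire e i p = .var (F.lit i p).var q := ⟨_, rfl⟩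
  rw [hq] at h ⊢
  simp only [oracleBits]
  rw [if_congr h rfl rfl]
  simp only [hi, true_and, Literal.Holds]
  generalize a (F.lit i p).var = v
  cases (F.lit i p).pos <;> fin_cases v <;> simp

lemma literalGates_run (b : F.Wire → Fin 2) :
    runCircuit (literalGates e i) (ket b) =
      ket fun w => if Flipped e {i} w then 1 - b w else b w := by
  rw [runCircuit_parallel_flips]
  · congr 1
    funext w
    refine if_congr ?_ rfl rfl
    simp [literalGates, Flipped]
  · simp [literalGates]
  · simp only [literalGates, List.map_map]
    refine (List.Nodup.filter _ (List.nodup_finRange _)).map fun p p' h => ?_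
    simpa using litWire_injective e h
  · simp [literalGates]

/-- The value `c` of the clause qubit is left free: the circuit needs `c = 0`, its inverse `c = 1`.
-/
lemma literalGates_run_bits (P : Finset (Fin F.m)) (hi : i ∉ P) (c : Fin 2) :
    (fun w => if Flipped e {i} w then
        1 - Function.update (oracleBits e P a f k) (.clause i) c w
      else Function.update (oracleBits e P a f k) (.clause i) c w) =
      Function.update (oracleBits e (insert i P) a f k) (.clause i) c := by
  have hdis : ∀ w, Flipped e {i} w → ¬ Flipped e P w := by
    rintro w ⟨i', hi', p, hp, rfl⟩ h
    rw [Finset.mem_singleton] at hi'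
    subst hi'
    exact hi ((flipped_litWire_iff e p).1 h).1
  have hins : ∀ w, Flipped e (insert i P) w ↔ Flipped e {i} w ∨ Flipped e P w := fun w => by
    simp [Flipped]
  have hno : ∀ w, (∀ j q, w ≠ .var j q) → ¬ Flipped e {i} w := by
    rintro w hw ⟨i', -, p, -, rfl⟩
    exact hw _ _ rfl
  funext w
  cases w with
  | var j q =>
    simp only [ne_eq, reduceCtorEq, not_false_eq_true, Function.update_of_ne, oracleBits]
    rw [if_congr (hins _) rfl rfl]
    have := hdis (.var j q)
    by_cases h1 : Flipped e {i} (.var j q)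
    · simp only [h1, this h1, if_true, if_false, or_false]
    · simp only [h1, if_false, false_or]
  | clause i' =>
    rw [if_neg (hno _ (by simp))]
    by_cases h : i' = i
    · subst h; simp
    · simp [Function.update_of_ne, h, oracleBits]
  | formula => rw [if_neg (hno _ (by simp))]; simp [oracleBits]
  | control => rw [if_neg (hno _ (by simp))]; simp [oracleBits]

lemma clauseNot_flip (hi : i ∈ P) (c : Fin 2) :
    flipBit ((List.finRange (F.width i)).map (litWire e i)) (.clause i)
      (Function.update (oracleBits e P a f k) (.clause i) c) =
    Function.update (oracleBits e P a f k) (.clause i)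
      (if ∃ p, (F.lit i p).Holds a then c else 1 - c) := by
  have hc : (∀ w ∈ (List.finRange (F.width i)).map (litWire e i),
      Function.update (oracleBits e P a f k) (.clause i) c w = 1) ↔
      ¬ ∃ p, (F.lit i p).Holds a := by
    simp only [List.mem_map, List.mem_finRange, true_and, forall_exists_index,
      forall_apply_eq_imp_iff, not_exists]
    refine forall_congr' fun p => ?_
    rw [Function.update_of_ne (by simp [litWire]), oracleBits_litWire e a f k hi]
  unfold flipBit
  rw [if_congr hc rfl rfl]
  by_cases h : ∃ p, (F.lit i p).Holds a
  · rw [if_neg (not_not.2 h), if_pos h]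
  · rw [if_pos h, if_neg h]; simp

lemma clause_notMem_controls :
    (Wire.clause i : F.Wire) ∉ (List.finRange (F.width i)).map (litWire e i) := by
  simp [litWire]

lemma update_clause_of_mem (hi : i ∈ P) :
    Function.update (oracleBits e P a f k) (.clause i)
      (if ∃ p, (F.lit i p).Holds a then 1 else 0) = oracleBits e P a f k := by
  conv_rhs => rw [← Function.update_eq_self (Wire.clause i) (oracleBits e P a f k)]
  simp [oracleBits, hi]

lemma update_clause_of_notMem (hi : i ∉ P) :
    Function.update (oracleBits e P a f k) (.clause i) 0 = oracleBits e P a f k := by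
  conv_rhs => rw [← Function.update_eq_self (Wire.clause i) (oracleBits e P a f k)]
  simp [oracleBits, hi]

lemma clauseCircuit_run (hi : i ∉ P) :
    runCircuit (clauseCircuit e i) (ket (oracleBits e P a f k)) =
      ket (oracleBits e (insert i P) a f k) := by
  have h0 := literalGates_run_bits e a f k P hi 0
  rw [update_clause_of_notMem e a f k hi] at h0
  rw [clauseCircuit, runCircuit_append, runCircuit_append, literalGates_run, h0,
    runCircuit_singleton, runCircuit_singleton, apply_matX_ket (by simp), clauseNot,
    apply_matX_ket (clause_notMem_controls e)]
  congr 1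
  rw [flipBit_nil]
  simp only [Function.update_self, Function.update_idem, sub_zero]
  rw [clauseNot_flip e a f k (Finset.mem_insert_self i P), sub_self,
    update_clause_of_mem e a f k (Finset.mem_insert_self i P)]

lemma clauseInverse_run (hi : i ∉ P) :
    runCircuit (clauseInverse e i) (ket (oracleBits e (insert i P) a f k)) =
      ket (oracleBits e P a f k) := by
  have hm := Finset.mem_insert_self i P
  rw [clauseInverse, runCircuit_append, runCircuit_append,
    runCircuit_singleton (clauseNot e i), runCircuit_singleton, clauseNot,
    apply_matX_ket (clause_notMem_controls e)]
  -- Whatever the truth value of the clause, the controlled NOT returns the clause qubit to `1`, and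
  -- the final `X` resets it to `0`.
  have h1 : flipBit ((List.finRange (F.width i)).map (litWire e i)) (.clause i)
      (oracleBits e (insert i P) a f k) =
      Function.update (oracleBits e (insert i P) a f k) (.clause i) 1 := by
    rw [← update_clause_of_mem e a f k hm, clauseNot_flip e a f k hm, Function.update_idem]
    split_ifs <;> simp
  -- The literal flips are involutive, so the forward computation is read backwards.
  have h2 : (fun w => if Flipped e {i} w then
        1 - Function.update (oracleBits e (insert i P) a f k) (.clause i) 1 w
      else Function.update (oracleBits e (insert i P) a f k) (.clause i) 1 w) =
      Function.update (oracleBits e P a f k) (.clause i) 1 := by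
    rw [← literalGates_run_bits e a f k P hi 1]
    funext w
    by_cases hw : Flipped e {i} w
    · simp only [hw, if_true, fin_two_flip_flip]
    · simp only [hw, if_false]
  rw [h1, literalGates_run, h2, apply_matX_ket (by simp)]
  congr 1
  rw [flipBit_nil]
  simp only [Function.update_self, Function.update_idem, sub_self]
  exact update_clause_of_notMem e a f k hi

lemma clauseCircuits_run (l : List (Fin F.m)) (hl : l.Nodup) (hP : ∀ i ∈ l, i ∉ P) :
    runCircuit (l.flatMap (clauseCircuit e)) (ket (oracleBits e P a f k)) =
      ket (oracleBits e (P ∪ l.toFinset) a f k) := by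
  induction l generalizing P with
  | nil => simp [runCircuit_nil]
  | cons i l ih =>
    rw [List.nodup_cons] at hl
    rw [List.flatMap_cons, runCircuit_append,
      clauseCircuit_run e a f k (hP i List.mem_cons_self), ih hl.2]
    · congr 2; ext x; simp
    · intro x hx
      rw [Finset.mem_insert, not_or]
      exact ⟨fun h => hl.1 (h ▸ hx), hP x (List.mem_cons_of_mem _ hx)⟩

/-- The inverses run in the same order as the circuits, not the reverse one; since each clause acts
on its own qubits, any processed clause can be undone first. -/
lemma clauseInverses_run (l : List (Fin F.m)) (hl : l.Nodup) (hP : ∀ i ∈ l, i ∉ P) :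
    runCircuit (l.flatMap (clauseInverse e)) (ket (oracleBits e (P ∪ l.toFinset) a f k)) =
      ket (oracleBits e P a f k) := by
  induction l generalizing P with
  | nil => simp [runCircuit_nil]
  | cons i l ih =>
    rw [List.nodup_cons] at hl
    have hu : P ∪ (i :: l).toFinset = insert i (P ∪ l.toFinset) := by ext x; simp
    rw [List.flatMap_cons, runCircuit_append, hu, clauseInverse_run,
      ih hl.2 fun x hx => hP x (List.mem_cons_of_mem _ hx)]
    simpa [hl.1] using hP i List.mem_cons_self

/-- The bits of `encode` with the value `k` of the control qubit. -/
def encodeBits (F : CNF n) (a : Fin n → Fin 2) (k : Fin 2) : F.Wire → Fin 2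
  | .var j _ => a j
  | .clause _ => 0
  | .formula => 0
  | .control => k

lemma oracleBits_empty : oracleBits e ∅ a 0 k = encodeBits F a k := by
  funext w
  cases w <;> simp [oracleBits, encodeBits, Flipped]

lemma allClauses_run :
    runCircuit ((List.finRange F.m).flatMap (clauseCircuit e)) (ket (encodeBits F a k)) =
      ket (oracleBits e Finset.univ a 0 k) := by
  rw [← oracleBits_empty e, clauseCircuits_run e a 0 k _ (List.nodup_finRange _) (by simp)]
  simp [List.toFinset_finRange]

lemma allClauses_undo :
    runCircuit ((List.finRange F.m).flatMap (clauseInverse e))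
      (ket (oracleBits e Finset.univ a 0 k)) = ket (encodeBits F a k) := by
  have := clauseInverses_run (P := ∅) e a 0 k _ (List.nodup_finRange F.m) (by simp)
  rw [oracleBits_empty] at this
  simpa [List.toFinset_finRange] using this

lemma formulaNot_apply :
    (formulaNot F).apply (ket (oracleBits e Finset.univ a f k)) =
      ket (oracleBits e Finset.univ a (if F.Sat a then 1 - f else f) k) := by
  rw [formulaNot, apply_matX_ket (by simp), flipBit]
  have h : (∀ c ∈ (List.finRange F.m).map Wire.clause, oracleBits e Finset.univ a f k c = 1) ↔
      F.Sat a := by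
    simp [oracleBits, Sat]
  rw [if_congr h rfl rfl]
  congr 1
  by_cases hs : F.Sat a
  · rw [if_pos hs, if_pos hs]
    funext w
    cases w <;> simp [oracleBits, Function.update_of_ne]
  · rw [if_neg hs, if_neg hs]

lemma control_apply (M : Matrix (Fin 2) (Fin 2) ℂ) :
    Gate.apply ⟨[], .control, M⟩ (ket (oracleBits e P a f k)) =
      ∑ l, M l k • ket (oracleBits e P a f l) := by
  rw [apply_single_ket]
  refine Finset.sum_congr rfl fun l _ => ?_
  congr 2
  funext w
  cases w <;> simp [oracleBits, Function.update_of_ne]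

lemma control_apply_encode (M : Matrix (Fin 2) (Fin 2) ℂ) :
    Gate.apply ⟨[], .control, M⟩ (ket (encodeBits F a k)) =
      ∑ l, M l k • ket (encodeBits F a l) := by
  rw [apply_single_ket]
  refine Finset.sum_congr rfl fun l _ => ?_
  congr 2
  funext w
  cases w <;> simp [encodeBits, Function.update_of_ne]

lemma oracle_core :
    runCircuit ([formulaNot F] ++ [⟨[.control], .formula, matZ⟩] ++ [formulaNot F] ++
        (List.finRange F.m).flatMap (clauseInverse e)) (ket (oracleBits e Finset.univ a 0 k)) =
      (if F.Sat a ∧ k = 1 then -1 else 1 : ℂ) • ket (encodeBits F a k) := by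
  simp only [runCircuit_append, runCircuit_singleton, formulaNot_apply, apply_matZ_ket]
  -- The gate is repackaged as a one-gate circuit so that the linearity of `runCircuit` pulls out
  -- the phase.
  rw [← runCircuit_nil (Gate.apply _ _), ← runCircuit_cons, runCircuit_smul, runCircuit_smul,
    runCircuit_singleton, formulaNot_apply]
  have : (if F.Sat a then 1 - (if F.Sat a then 1 - 0 else 0 : Fin 2) else
      (if F.Sat a then 1 - 0 else 0 : Fin 2)) = 0 := by split_ifs <;> rfl
  rw [this, allClauses_undo]
  congr 1
  refine if_congr ?_ rfl rfl
  simp [oracleBits, and_comm]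

/-- On a satisfying assignment the control undergoes `R_y(-φ) Z R_y(φ)`, whose half-angle products
combine by the double-angle formulas; otherwise the two rotations cancel. -/
lemma oracle_run (φ : ℝ) :
    runCircuit (oracle e φ) (ket (encodeBits F a 1)) =
      if F.Sat a then (-(Real.sin φ : ℂ)) • ket (encodeBits F a 0) +
        (-(Real.cos φ : ℂ)) • ket (encodeBits F a 1)
      else ket (encodeBits F a 1) := by
  have hc : oracle e φ = (List.finRange F.m).flatMap (clauseCircuit e) ++
      ([⟨[], .control, matRy φ⟩] ++ (([formulaNot F] ++ [⟨[.control], .formula, matZ⟩] ++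
        [formulaNot F] ++ (List.finRange F.m).flatMap (clauseInverse e)) ++
        [⟨[], .control, matRy (-φ)⟩])) := by
    simp [oracle]
  have hs : (Real.sin φ : ℂ) = 2 * (Real.sin (φ / 2) : ℂ) * (Real.cos (φ / 2) : ℂ) := by
    rw [← Complex.ofReal_ofNat, ← Complex.ofReal_mul, ← Complex.ofReal_mul, ← Real.sin_two_mul]
    congr 2; ring
  have hcs : (Real.cos φ : ℂ) = (Real.cos (φ / 2) : ℂ) ^ 2 - (Real.sin (φ / 2) : ℂ) ^ 2 := by
    rw [← Complex.ofReal_pow, ← Complex.ofReal_pow, ← Complex.ofReal_sub, ← Real.cos_two_mul']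
    congr 2; ring
  have h1 : (Real.cos (φ / 2) : ℂ) ^ 2 + (Real.sin (φ / 2) : ℂ) ^ 2 = 1 := by
    rw [← Complex.ofReal_pow, ← Complex.ofReal_pow, ← Complex.ofReal_add,
      Real.cos_sq_add_sin_sq, Complex.ofReal_one]
  rw [hc, runCircuit_append, allClauses_run, runCircuit_append, runCircuit_singleton,
    control_apply, runCircuit_append]
  simp only [runCircuit_sum, runCircuit_smul, oracle_core]
  simp only [runCircuit_singleton, control_apply_encode, Fin.sum_univ_two, matRy, neg_div,
    Real.cos_neg, Real.sin_neg, Complex.ofReal_neg, hs, hcs]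
  generalize (Real.cos (φ / 2) : ℂ) = c at h1
  generalize (Real.sin (φ / 2) : ℂ) = s at h1
  rw [if_neg fun h => absurd h.2 (by decide)]
  by_cases h : F.Sat a
  · rw [if_pos ⟨h, trivial⟩, if_pos h]
    simp
    module
  · rw [if_neg fun h' => h h'.1, if_neg h]
    conv_rhs => rw [← one_smul ℂ (ket (encodeBits F a 1)), ← h1]
    simp
    module

end CNF

end

noncomputable section

namespace CNF

variable {n : ℕ} {F : CNF n}

/-! ### The controlled diffuser -/

/-- The bits of the disentangled groups: the zeroth qubits carry the assignment `a`, the control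
qubit `k` and all others `0`. -/
def disentangledBits (F : CNF n) (a : Fin n → Fin 2) (k : Fin 2) : F.Wire → Fin 2
  | .var j i => if i.val = 0 then a j else 0
  | .clause _ => 0
  | .formula => 0
  | .control => k

variable (a : Fin n → Fin 2) (k : Fin 2)

lemma mem_groupCNOTs (g : Gate F.Wire) :
    g ∈ groupCNOTs F ↔ ∃ j, ∃ i : Fin (F.groupSize j), i.val ≠ 0 ∧
      g = ⟨[F.zeroth j], .var j i, matX⟩ := by
  simp only [groupCNOTs, List.mem_flatMap, List.mem_finRange, true_and, List.mem_map,
    List.mem_filter, decide_eq_true_eq]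
  exact exists_congr fun j => exists_congr fun i => and_congr_right fun _ => eq_comm

lemma groupCNOTs_targets_nodup : ((groupCNOTs F).map Gate.target).Nodup := by
  rw [groupCNOTs, List.map_flatMap, List.nodup_flatMap]
  constructor
  · intro j _
    rw [List.map_map]
    refine (List.Nodup.filter _ (List.nodup_finRange _)).map fun i i' h => ?_
    simpa using h
  · refine (List.nodup_finRange n).imp_of_mem ?_
    intro j j' _ _ hjj' w hw hw'
    simp only [List.map_map, List.mem_map, Function.comp_apply] at hw hw'
    obtain ⟨i, -, rfl⟩ := hw
    obtain ⟨i', -, h⟩ := hw'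
    injection h with h
    exact hjj' h.symm

lemma groupCNOTs_run (b : F.Wire → Fin 2) :
    runCircuit (groupCNOTs F) (ket b) = ket fun w =>
      if ∃ j, ∃ i : Fin (F.groupSize j), i.val ≠ 0 ∧ w = .var j i ∧ b (F.zeroth j) = 1
      then 1 - b w else b w := by
  rw [runCircuit_parallel_flips _ _ groupCNOTs_targets_nodup]
  · congr 1
    funext w
    refine if_congr ?_ rfl rfl
    constructor
    · rintro ⟨g, hg, rfl, hb⟩
      obtain ⟨j, i, hi, rfl⟩ := (mem_groupCNOTs g).1 hg
      exact ⟨j, i, hi, rfl, hb _ (by simp)⟩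
    · rintro ⟨j, i, hi, rfl, hb⟩
      exact ⟨_, (mem_groupCNOTs _).2 ⟨j, i, hi, rfl⟩, rfl, by simpa using hb⟩
  · intro g hg h hh c hc
    obtain ⟨j, i, hi, rfl⟩ := (mem_groupCNOTs g).1 hg
    obtain ⟨j', i', hi', rfl⟩ := (mem_groupCNOTs h).1 hh
    rw [List.mem_singleton] at hc
    subst hc
    intro hz
    have hj : j = j' := by injection hz
    subst hj
    exact hi' (by rw [← eq_of_heq (Wire.var.inj hz).2])
  · intro g hg
    obtain ⟨j, i, hi, rfl⟩ := (mem_groupCNOTs g).1 hg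
    rfl

/-- A common criterion for disentangling and re-entangling the groups. -/
lemma groupCNOTs_run_bits (b b' : F.Wire → Fin 2) (hz : ∀ j, b (F.zeroth j) = a j)
    (h0 : ∀ j, ∀ i : Fin (F.groupSize j), i.val = 0 → b' (.var j i) = b (.var j i))
    (h1 : ∀ j, ∀ i : Fin (F.groupSize j), i.val ≠ 0 → b' (.var j i) =
      if a j = 1 then 1 - b (.var j i) else b (.var j i))
    (h2 : ∀ w, (∀ j i, w ≠ .var j i) → b' w = b w) :
    runCircuit (groupCNOTs F) (ket b) = ket b' := by
  rw [groupCNOTs_run]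
  congr 1
  funext w
  by_cases hw : ∃ j i, w = .var j i
  · obtain ⟨j, i, rfl⟩ := hw
    have hiff : (∃ j', ∃ i' : Fin (F.groupSize j'), i'.val ≠ 0 ∧
        (Wire.var j i : F.Wire) = .var j' i' ∧ b (F.zeroth j') = 1) ↔ i.val ≠ 0 ∧ a j = 1 := by
      constructor
      · rintro ⟨j', i', hi', h, hb⟩
        have hj : j = j' := by injection h
        subst hj
        rw [eq_of_heq (Wire.var.inj h).2]
        exact ⟨hi', hz j ▸ hb⟩
      · rintro ⟨hi, ha⟩
        exact ⟨j, i, hi, rfl, (hz j).trans ha⟩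
    rw [if_congr hiff rfl rfl]
    by_cases hi : i.val = 0
    · rw [if_neg (by simp [hi]), h0 j i hi]
    · rw [h1 j i hi]
      simp [hi]
  · push Not at hw
    rw [if_neg, h2 w hw]
    rintro ⟨j, i, -, h, -⟩
    exact hw j i h

lemma groupCNOTs_encode :
    runCircuit (groupCNOTs F) (ket (encodeBits F a k)) = ket (disentangledBits F a k) := by
  refine groupCNOTs_run_bits a _ _ (fun _ => rfl) (fun j i hi => ?_) (fun j i hi => ?_)
    fun w hw => ?_
  · simp [disentangledBits, encodeBits, hi]
  · simp only [disentangledBits, encodeBits, hi, if_false]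
    generalize a j = v
    fin_cases v <;> simp
  · cases w
    · exact absurd rfl (hw _ _)
    all_goals rfl

lemma groupCNOTs_disentangled :
    runCircuit (groupCNOTs F) (ket (disentangledBits F a k)) = ket (encodeBits F a k) := by
  refine groupCNOTs_run_bits a _ _ (fun _ => rfl) (fun j i hi => ?_) (fun j i hi => ?_)
    fun w hw => ?_
  · simp [disentangledBits, encodeBits, hi]
  · simp only [disentangledBits, encodeBits, hi, if_false]
    generalize a j = v
    fin_cases v <;> simp
  · cases w
    · exact absurd rfl (hw _ _)
    all_goals rfl

/-- The product state with the single-qubit states `v j` on the qubits `x_j^0`, the control qubit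
in the state `k` and the other qubits in the state `0`. -/
def productState (F : CNF n) (v : Fin n → Fin 2 → ℂ) (k : Fin 2) : QState F.Wire :=
  ∑ a, (∏ j, v j (a j)) • ket (disentangledBits F a k)

lemma disentangledBits_eq_iff (b : F.Wire → Fin 2) :
    b = disentangledBits F a k ↔
      b = disentangledBits F (fun j => b (F.zeroth j)) k ∧ a = fun j => b (F.zeroth j) := by
  constructor
  · rintro rfl
    exact ⟨rfl, rfl⟩
  · rintro ⟨h, rfl⟩
    exact h

lemma productState_apply (v : Fin n → Fin 2 → ℂ) (b : F.Wire → Fin 2) :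
    productState F v k b = if b = disentangledBits F (fun j => b (F.zeroth j)) k
      then ∏ j, v j (b (F.zeroth j)) else 0 := by
  simp only [productState, WithLp.ofLp_sum, Finset.sum_apply, PiLp.smul_apply, ket_apply,
    smul_eq_mul, mul_ite, mul_one, mul_zero]
  rw [Finset.sum_eq_single fun j => b (F.zeroth j)]
  · intro a _ ha
    rw [if_neg fun h => ha ((disentangledBits_eq_iff a k b).1 h).2]
  · simp

lemma zeroth_injective : Function.Injective F.zeroth := by
  intro j j' h
  injection h

lemma productState_single : productState F (fun j => Pi.single (a j) 1) k =
    ket (disentangledBits F a k) := by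
  rw [productState, Finset.sum_eq_single a]
  · simp
  · intro a' _ h
    obtain ⟨j, hj⟩ := Function.ne_iff.1 h
    rw [Finset.prod_eq_zero (Finset.mem_univ j), zero_smul]
    rw [Pi.single_eq_of_ne hj]
  · simp

lemma productState_const (c : ℂ) : productState F (fun _ _ => c) k =
    c ^ n • ∑ a, ket (disentangledBits F a k) := by
  simp [productState, Finset.smul_sum]

lemma update_zeroth (j : Fin n) (l : Fin 2) :
    Function.update (disentangledBits F a k) (F.zeroth j) l =
      disentangledBits F (Function.update a j l) k := by
  funext w
  by_cases hw : w = F.zeroth j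
  · subst hw
    simp [zeroth, disentangledBits]
  · rw [Function.update_of_ne hw]
    cases w with
    | var j' i =>
      simp only [disentangledBits]
      by_cases hi : i.val = 0
      · have : j' ≠ j := by
          rintro rfl
          exact hw (by unfold zeroth; congr 1; exact Fin.ext hi)
        simp [hi, this]
      · simp [hi]
    | clause | formula | control => rfl

lemma zeroth_gate_apply (M : Matrix (Fin 2) (Fin 2) ℂ) (j : Fin n) (v : Fin n → Fin 2 → ℂ) :
    Gate.apply ⟨[], F.zeroth j, M⟩ (productState F v k) =
      productState F (Function.update v j (M.mulVec (v j))) k := by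
  ext b
  -- Being of disentangled form does not depend on the bit at `x_j^0`, so the gate's sum only meets
  -- the factor `v j`.
  have h1 : ∀ l, (Function.update b (F.zeroth j) l =
      disentangledBits F (fun i => Function.update b (F.zeroth j) l (F.zeroth i)) k) ↔
      b = disentangledBits F (fun i => b (F.zeroth i)) k := by
    intro l
    have : (fun i => Function.update b (F.zeroth j) l (F.zeroth i)) =
        Function.update (fun i => b (F.zeroth i)) j l :=
      Function.update_comp_eq_of_injective b zeroth_injective j l
    rw [this, ← update_zeroth]
    constructor
    · intro h
      have h' := congrArg (fun x => Function.update x (F.zeroth j) (b (F.zeroth j))) h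
      simp only [Function.update_idem, Function.update_eq_self] at h'
      rw [update_zeroth] at h'
      simpa [Function.update_eq_self_iff] using h'
    · intro h
      exact congrArg (fun x => Function.update x (F.zeroth j) l) h
  have h2 : ∀ l, ∏ i, v i (Function.update b (F.zeroth j) l (F.zeroth i)) =
      v j l * ∏ i ∈ Finset.univ.erase j, v i (b (F.zeroth i)) := by
    intro l
    rw [← Finset.mul_prod_erase _ _ (Finset.mem_univ j), Function.update_self]
    congr 1
    refine Finset.prod_congr rfl fun i hi => ?_
    rw [Function.update_of_ne (zeroth_injective.ne (Finset.ne_of_mem_erase hi))]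
  have h3 : ∏ i, Function.update v j (M.mulVec (v j)) i (b (F.zeroth i)) =
      M.mulVec (v j) (b (F.zeroth j)) * ∏ i ∈ Finset.univ.erase j, v i (b (F.zeroth i)) := by
    rw [← Finset.mul_prod_erase _ _ (Finset.mem_univ j), Function.update_self]
    congr 1
    refine Finset.prod_congr rfl fun i hi => ?_
    rw [Function.update_of_ne (Finset.ne_of_mem_erase hi)]
  simp only [Gate.apply, productState_apply, List.not_mem_nil, IsEmpty.forall_iff, implies_true,
    if_true, h1, h2, h3]
  split_ifs
  · simp only [Matrix.mulVec, dotProduct, Finset.sum_mul, mul_assoc]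
  · simp

lemma onZeroths_run (M : Matrix (Fin 2) (Fin 2) ℂ) (v : Fin n → Fin 2 → ℂ) :
    runCircuit (onZeroths F M) (productState F v k) =
      productState F (fun j => M.mulVec (v j)) k := by
  have key : ∀ (l : List (Fin n)) (v : Fin n → Fin 2 → ℂ), l.Nodup →
      runCircuit (l.map fun j => (⟨[], F.zeroth j, M⟩ : Gate F.Wire)) (productState F v k) =
        productState F (fun j => if j ∈ l then M.mulVec (v j) else v j) k := by
    intro l
    induction l with
    | nil => intro v _; simp [runCircuit_nil]
    | cons j l ih =>
      intro v hl
      rw [List.nodup_cons] at hl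
      rw [List.map_cons, runCircuit_cons, zeroth_gate_apply, ih _ hl.2]
      congr 1
      funext i
      by_cases hi : i = j
      · subst hi
        simp [hl.1]
      · simp [hi]
  rw [onZeroths, key _ _ (List.nodup_finRange n)]
  simp

lemma controlledZ_apply_zero (v : Fin n → Fin 2 → ℂ) :
    Gate.apply ⟨(List.finRange n).map F.zeroth, .control, matZ⟩ (productState F v 0) =
      productState F v 0 := by
  have h := runCircuit_sum (W := F.Wire) [⟨(List.finRange n).map F.zeroth, .control, matZ⟩]
    Finset.univ fun a => (∏ j, v j (a j)) • ket (disentangledBits F a 0)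
  simp only [runCircuit_smul] at h
  simp only [runCircuit_singleton, apply_matZ_ket] at h
  rw [productState, h]
  simp [disentangledBits]

/-- Only the all-ones assignment changes sign, which amounts to subtracting twice its component. -/
lemma controlledZ_apply_one (v : Fin n → Fin 2 → ℂ) :
    Gate.apply ⟨(List.finRange n).map F.zeroth, .control, matZ⟩ (productState F v 1) =
      productState F v 1 - (2 * ∏ j, v j 1) • productState F (fun _ => Pi.single 1 1) 1 := by
  have h := runCircuit_sum (W := F.Wire) [⟨(List.finRange n).map F.zeroth, .control, matZ⟩]
    Finset.univ fun a => (∏ j, v j (a j)) • ket (disentangledBits F a 1)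
  simp only [runCircuit_smul] at h
  simp only [runCircuit_singleton, apply_matZ_ket] at h
  rw [productState_single (fun _ => 1), productState, h,
    ← Finset.add_sum_erase _ _ (Finset.mem_univ fun _ => 1),
    ← Finset.add_sum_erase (a := fun _ => 1) _ _ (Finset.mem_univ fun _ => 1)]
  have h1 : ∀ a ∈ Finset.univ.erase (fun _ : Fin n => (1 : Fin 2)),
      (∏ j, v j (a j)) • (if (∀ c ∈ (List.finRange n).map F.zeroth,
        disentangledBits F a 1 c = 1) ∧ disentangledBits F a 1 .control = 1 then (-1 : ℂ) else 1) •
        ket (disentangledBits F a 1) = (∏ j, v j (a j)) • ket (disentangledBits F a 1) := by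
    intro a ha
    rw [if_neg, one_smul]
    rintro ⟨hc, -⟩
    refine Finset.ne_of_mem_erase ha (funext fun j => ?_)
    exact hc (F.zeroth j) (List.mem_map_of_mem (List.mem_finRange j))
  rw [Finset.sum_congr rfl h1, if_pos]
  · module
  · simp [disentangledBits, zeroth]

lemma matX_mulVec_matX (v : Fin 2 → ℂ) : matX.mulVec (matX.mulVec v) = v := by
  funext i
  fin_cases i <;> simp [matX, Matrix.mulVec, dotProduct]

lemma sqrt_two_inv_sq : ((1 / √2 : ℝ) : ℂ) * ((1 / √2 : ℝ) : ℂ) = 1 / 2 := by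
  rw [← Complex.ofReal_mul]
  have : (1 / √2 : ℝ) * (1 / √2) = 1 / 2 := by
    rw [div_mul_div_comm, Real.mul_self_sqrt (by norm_num), one_mul]
  rw [this]; simp

lemma matH_mulVec_matH (v : Fin 2 → ℂ) : matH.mulVec (matH.mulVec v) = v := by
  rw [Matrix.mulVec_mulVec]
  have : matH * matH = 1 := by
    rw [matH, smul_mul_smul_comm, sqrt_two_inv_sq]
    ext i j
    fin_cases i <;> fin_cases j <;> norm_num [Matrix.mul_apply]
  rw [this, Matrix.one_mulVec]

lemma matH_mulVec_single_zero :
    matH.mulVec (Pi.single 0 1) = fun _ => ((1 / √2 : ℝ) : ℂ) := by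
  funext i
  fin_cases i <;> simp [matH]

lemma matX_mulVec_single_one : matX.mulVec (Pi.single 1 1) = Pi.single 0 1 := by
  funext i
  fin_cases i <;> simp [matX, Matrix.mulVec, dotProduct]

lemma matX_matH_mulVec_single_one (l : Fin 2) :
    matX.mulVec (matH.mulVec (Pi.single l 1)) 1 = ((1 / √2 : ℝ) : ℂ) := by
  fin_cases l <;> simp [matH, matX, Matrix.vecHead, Matrix.vecTail]

lemma diffuser_run_zero :
    runCircuit (diffuser F) (ket (encodeBits F a 0)) = ket (encodeBits F a 0) := by
  simp only [diffuser, runCircuit_append, groupCNOTs_encode]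
  rw [← productState_single]
  simp only [onZeroths_run, runCircuit_singleton, controlledZ_apply_zero,
    matX_mulVec_matX, matH_mulVec_matH]
  rw [productState_single, groupCNOTs_disentangled]

/-- Conjugation by `X` and `H` turns the all-ones state into the uniform one. The factor `2 / 2 ^ n`
collects one `(1 / √2) ^ n` from the overlap and one from the amplitudes of the uniform state. -/
lemma diffuser_run_one :
    runCircuit (diffuser F) (ket (encodeBits F a 1)) = ket (encodeBits F a 1) -
      (2 / 2 ^ n : ℂ) • ∑ a', ket (encodeBits F a' 1) := by
  simp only [diffuser, runCircuit_append, groupCNOTs_encode]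
  rw [← productState_single]
  simp only [onZeroths_run]
  rw [runCircuit_singleton, controlledZ_apply_one]
  simp only [runCircuit_sub, runCircuit_smul, onZeroths_run, matX_mulVec_matX, matH_mulVec_matH,
    matX_mulVec_single_one, matH_mulVec_single_zero, productState_const,
    matX_matH_mulVec_single_one]
  rw [productState_single]
  simp only [runCircuit_sum, groupCNOTs_disentangled, smul_smul]
  congr 2
  rw [Finset.prod_const, Finset.card_univ, Fintype.card_fin, mul_assoc, ← mul_pow,
    sqrt_two_inv_sq]
  simp [div_eq_mul_inv]

end CNF

end

/-! ### The amplitudes of the satisfying and the falsifying assignments -/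

/-- The effect of a continuing iteration with the cosine `c` on the amplitudes `u.1` of each of the
`M` satisfying assignments and `u.2` of each of the `K` falsifying ones. -/
noncomputable def amplitudeStep (M K c : ℝ) (u : ℝ × ℝ) : ℝ × ℝ :=
  (-(c * u.1) - 2 / (M + K) * (-(M * (c * u.1)) + K * u.2),
    u.2 - 2 / (M + K) * (-(M * (c * u.1)) + K * u.2))

/-- The squared norm of the state with the amplitudes `u`. -/
def amplitudeMass (M K : ℝ) (u : ℝ × ℝ) : ℝ := M * u.1 ^ 2 + K * u.2 ^ 2

/-- Subtracting twice the mean is a reflection for the weighted norm, so only the factor `c` on the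
first amplitude changes the mass. -/
lemma amplitudeMass_step {M K : ℝ} (h : M + K ≠ 0) (c : ℝ) (u : ℝ × ℝ) :
    amplitudeMass M K (amplitudeStep M K c u) = M * c ^ 2 * u.1 ^ 2 + K * u.2 ^ 2 := by
  simp only [amplitudeMass, amplitudeStep]
  field_simp
  ring

lemma amplitudeMass_nonneg {M K : ℝ} (hM : 0 ≤ M) (hK : 0 ≤ K) (u : ℝ × ℝ) :
    0 ≤ amplitudeMass M K u := by
  unfold amplitudeMass; positivity

/-- If the mass is not small, then the first component is not small now or after one step. -/
lemma amplitudeMass_le {M K : ℕ} (hM : 0 < M) {c : ℝ} (hc : |c| ≤ 1) (u : ℝ × ℝ) :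
    amplitudeMass M K u ≤
      ((M + K : ℝ) + (M + K) ^ 2) * (u.1 ^ 2 + (amplitudeStep M K c u).1 ^ 2) := by
  obtain ⟨x, y⟩ := u
  have hM0 : (0 : ℝ) < M := by exact_mod_cast hM
  have hK0 : (0 : ℝ) ≤ K := by positivity
  have hN : (0 : ℝ) < M + K := by positivity
  set x' := (amplitudeStep M K c (x, y)).1 with hx'
  -- Integrality of `K` bounds `K * y ^ 2` by `(K * y) ^ 2`, the quantity that `key` controls,
  -- including the case `K = 0`.
  have hK2 : (K : ℝ) ≤ K ^ 2 := by
    have : K ≤ K ^ 2 := Nat.le_self_pow (by norm_num) K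
    exact_mod_cast this
  have key : 2 * (K * y) = -((M + K) * x') + c * x * (M - K) := by
    rw [hx', amplitudeStep]
    field_simp
    ring
  have h1 : (c * x * (M - K)) ^ 2 ≤ (M + K) ^ 2 * x ^ 2 := by
    have hc2 : c ^ 2 ≤ 1 := by rw [← sq_abs]; exact pow_le_one₀ (abs_nonneg _) hc
    have hMK : ((M : ℝ) - K) ^ 2 ≤ (M + K) ^ 2 := by nlinarith
    calc (c * x * (M - K)) ^ 2 = c ^ 2 * (M - K) ^ 2 * x ^ 2 := by ring
      _ ≤ 1 * (M + K) ^ 2 * x ^ 2 := by gcongr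
      _ = _ := by ring
  have h2 : (2 * (K * y)) ^ 2 ≤ 4 * ((M + K) ^ 2 * (x ^ 2 + x' ^ 2)) := by
    rw [key]
    nlinarith [sq_nonneg ((M + K) * x' + c * x * (M - K)), sq_nonneg ((M + K : ℝ) * x),
      sq_nonneg ((M + K : ℝ) * x')]
  have h3 : K * y ^ 2 ≤ (M + K) ^ 2 * (x ^ 2 + x' ^ 2) := by
    have := mul_le_mul_of_nonneg_right hK2 (sq_nonneg y)
    nlinarith
  have h4 : M * x ^ 2 ≤ (M + K) * (x ^ 2 + x' ^ 2) := by
    nlinarith [sq_nonneg x, sq_nonneg x', mul_nonneg hK0 (sq_nonneg x),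
      mul_nonneg hN.le (sq_nonneg x')]
  simp only [amplitudeMass]
  linarith

lemma amplitudeMass_tendsto_zero {M K : ℕ} (hM : 0 < M) (c : ℕ → ℝ) (hc : ∀ t, |c t| ≤ 1)
    (hc' : ∀ t : ℕ, 1 ≤ t → 1 / ((t : ℝ) + 1) ≤ 1 - c t ^ 2) (u : ℕ → ℝ × ℝ)
    (hu : ∀ t, u (t + 1) = amplitudeStep M K (c t) (u t)) :
    Tendsto (fun t => amplitudeMass M K (u t)) atTop (𝓝 0) := by
  have hM1 : (1 : ℝ) ≤ M := by exact_mod_cast hM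
  have hK0 : (0 : ℝ) ≤ K := by positivity
  have hN : (0 : ℝ) < M + K := by positivity
  set p := fun t => amplitudeMass M K (u t) with hp
  have hp0 : ∀ t, 0 ≤ p t := fun t => amplitudeMass_nonneg (by positivity) hK0 _
  have hdrop : ∀ t, p t - p (t + 1) = M * (1 - c t ^ 2) * (u t).1 ^ 2 := fun t => by
    simp only [hp]
    rw [hu, amplitudeMass_step hN.ne', amplitudeMass]
    ring
  have hc2 : ∀ t, 0 ≤ 1 - c t ^ 2 := fun t => by
    rw [sub_nonneg, ← sq_abs]; exact pow_le_one₀ (abs_nonneg _) (hc t)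
  have hanti : Antitone p := antitone_nat_of_succ_le fun t => by
    have : 0 ≤ M * (1 - c t ^ 2) * (u t).1 ^ 2 := by have := hc2 t; positivity
    linarith [hdrop t]
  have hbdd : BddBelow (Set.range p) := ⟨0, by rintro _ ⟨t, rfl⟩; exact hp0 t⟩
  have hlim := tendsto_atTop_ciInf hanti hbdd
  suffices h : ⨅ t, p t = 0 by rwa [h] at hlim
  refine le_antisymm (not_lt.1 fun hL => ?_) (le_ciInf hp0)
  set L := ⨅ t, p t with hLdef
  have hLp : ∀ t, L ≤ p t := fun t => ciInf_le hbdd t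
  set C : ℝ := (M + K : ℝ) + (M + K) ^ 2 with hC
  have hCpos : 0 < C := by positivity
  -- Indices start at `t + 1` because nothing bounds `c 0` away from `±1`; `1 / (t + 3)` is the
  -- weaker of the two bounds for the steps `t + 1` and `t + 2`.
  have hstep : ∀ t, L / C * (1 / ((t + 3 : ℕ) : ℝ)) ≤ p (t + 1) - p (t + 3) := by
    intro t
    have hd : ∀ s, 1 ≤ s → s ≤ t + 2 →
        1 / ((t + 3 : ℕ) : ℝ) * (u s).1 ^ 2 ≤ p s - p (s + 1) := by
      intro s hs hst
      rw [hdrop]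
      have h1 : 1 / ((t + 3 : ℕ) : ℝ) ≤ 1 - c s ^ 2 := by
        refine le_trans ?_ (hc' s hs)
        apply one_div_le_one_div_of_le (by positivity)
        have : s + 1 ≤ t + 3 := by omega
        exact_mod_cast this
      have h2 : 1 - c s ^ 2 ≤ M * (1 - c s ^ 2) := le_mul_of_one_le_left (hc2 s) hM1
      gcongr
      exact h1.trans h2
    have h1 := hd (t + 1) (by omega) (by omega)
    have h2 := hd (t + 2) (by omega) le_rfl
    have h3 : L / C ≤ (u (t + 1)).1 ^ 2 + (u (t + 2)).1 ^ 2 := by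
      rw [div_le_iff₀' hCpos]
      refine (hLp (t + 1)).trans ?_
      rw [hu (t + 1)]
      exact amplitudeMass_le hM (hc (t + 1)) _
    calc L / C * (1 / ((t + 3 : ℕ) : ℝ))
        ≤ ((u (t + 1)).1 ^ 2 + (u (t + 2)).1 ^ 2) * (1 / ((t + 3 : ℕ) : ℝ)) := by gcongr
      _ ≤ p (t + 1) - p (t + 3) := by linarith
  have hsum : Summable fun t : ℕ => L / C * (1 / ((t + 3 : ℕ) : ℝ)) := by
    refine summable_of_sum_range_le (c := p 1 + p 2) (fun t => by positivity) fun T => ?_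
    -- The two-step drops overlap, so the telescoping sum leaves two terms at each end.
    have : ∀ T, ∑ t ∈ Finset.range T, (p (t + 1) - p (t + 3)) =
        p 1 + p 2 - p (T + 1) - p (T + 2) := by
      intro T
      induction T with
      | zero => simp
      | succ T ih => rw [Finset.sum_range_succ, ih]; ring_nf
    calc _ ≤ ∑ t ∈ Finset.range T, (p (t + 1) - p (t + 3)) :=
          Finset.sum_le_sum fun t _ => hstep t
      _ ≤ _ := by rw [this]; linarith [hp0 (T + 1), hp0 (T + 2)]
  rw [summable_mul_left_iff (div_pos hL hCpos).ne',
    summable_nat_add_iff 3 (f := fun t : ℕ => 1 / (t : ℝ))] at hsum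
  exact Real.not_summable_one_div_natCast hsum

/-- The angle rule keeps the squared cosine away from `1` by a non-summable amount. -/
lemma inv_le_one_sub_sq_of_rule {t : ℕ} (ht : 2 ≤ t) {c : ℝ}
    (hc : c = (1 - Real.sin (Real.pi / (2 * (t : ℝ)))) / (1 + Real.sin (Real.pi / (2 * (t : ℝ))))) :
    1 / (t : ℝ) ≤ 1 - c ^ 2 := by
  have ht2 : (2 : ℝ) ≤ t := by exact_mod_cast ht
  have hpi := Real.pi_pos
  -- Jordan's inequality `2 / π * x ≤ sin x` on `[0, π / 2]`.
  have hs : 1 / (t : ℝ) ≤ Real.sin (Real.pi / (2 * (t : ℝ))) := by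
    have := Real.mul_le_sin (x := Real.pi / (2 * (t : ℝ))) (by positivity)
      (by apply div_le_div_of_nonneg_left hpi.le (by norm_num); linarith)
    convert this using 1
    field_simp
  have hs1 := Real.sin_le_one (Real.pi / (2 * (t : ℝ)))
  generalize Real.sin (Real.pi / (2 * (t : ℝ))) = s at *
  have h0 : 0 < s := lt_of_lt_of_le (by positivity) hs
  have : 1 - c ^ 2 = 4 * s / (1 + s) ^ 2 := by
    rw [hc]; field_simp; ring
  rw [this]
  -- From `s ≤ 1` follows `(1 + s) ^ 2 ≤ 4`, hence `s ≤ 4 * s / (1 + s) ^ 2`.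
  refine hs.trans ?_
  rw [le_div_iff₀ (by positivity)]
  nlinarith [mul_nonneg h0.le (sub_nonneg.2 hs1), mul_nonneg h0.le h0.le]

noncomputable section

/-! ### Projections and post-measurement states -/

section Measurement

variable {W : Type} [Fintype W] [DecidableEq W]

lemma projectBit_add (w : W) (k : Fin 2) (ψ ξ : QState W) :
    projectBit w k (ψ + ξ) = projectBit w k ψ + projectBit w k ξ := by
  ext b
  simp only [projectBit, PiLp.add_apply]
  split_ifs <;> simp

lemma projectBit_smul (w : W) (k : Fin 2) (z : ℂ) (ψ : QState W) :
    projectBit w k (z • ψ) = z • projectBit w k ψ := by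
  ext b
  simp only [projectBit, PiLp.smul_apply]
  split_ifs <;> simp

lemma norm_measurePost (w : W) (k : Fin 2) (ψ : QState W) (h : measureProb w k ψ ≠ 0) :
    ‖measurePost w k ψ‖ = 1 := by
  have h0 : ‖projectBit w k ψ‖ ≠ 0 := fun h0 => h (by simp [measureProb, h0])
  rw [measurePost, norm_smul, Complex.norm_real, norm_inv, norm_norm, inv_mul_cancel₀ h0]

end Measurement

namespace CNF

variable {n : ℕ} {F : CNF n}

/-! ### The states of the algorithm -/

/-- The number of falsifying assignments. -/
def falsifyingCount (F : CNF n) : ℕ := (Finset.univ.filter fun a => ¬ F.Sat a).card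

lemma solutions_card_add (F : CNF n) : F.solutions.card + F.falsifyingCount = 2 ^ n := by
  rw [solutions, falsifyingCount, Finset.card_filter_add_card_filter_not]
  simp

lemma solutions_card_add_cast (F : CNF n) :
    (F.solutions.card : ℝ) + F.falsifyingCount = 2 ^ n := by
  exact_mod_cast F.solutions_card_add

lemma sum_sat_ite {V : Type*} [AddCommMonoid V] (F : CNF n) (v w : V) :
    ∑ a, (if F.Sat a then v else w) = F.solutions.card • v + F.falsifyingCount • w := by
  rw [Finset.sum_ite, Finset.sum_const, Finset.sum_const]
  rfl

/-- The state in which the satisfying assignments have the amplitude `u.1`, the falsifying ones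
`u.2`, and the control qubit has the value `k`. -/
def assignmentState (F : CNF n) (u : ℝ × ℝ) (k : Fin 2) : QState F.Wire :=
  ∑ a, ((if F.Sat a then u.1 else u.2 : ℝ) : ℂ) • ket (encodeBits F a k)

lemma encodeBits_injective (k : Fin 2) : Function.Injective fun a => encodeBits F a k :=
  fun _ _ h => funext fun j => congrFun h (F.zeroth j)

lemma norm_assignmentState_sq (u : ℝ × ℝ) (k : Fin 2) :
    ‖assignmentState F u k‖ ^ 2 = amplitudeMass F.solutions.card F.falsifyingCount u := by
  have ho : Orthonormal ℂ fun a => ket (encodeBits F a k) := by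
    have := (EuclideanSpace.basisFun (F.Wire → Fin 2) ℂ).orthonormal.comp _
      (encodeBits_injective (F := F) k)
    simp only [Function.comp_def, EuclideanSpace.basisFun_apply] at this
    exact this
  have hn : ((‖assignmentState F u k‖ ^ 2 : ℝ) : ℂ) =
      inner ℂ (assignmentState F u k) (assignmentState F u k) := by
    rw [inner_self_eq_norm_sq_to_K, Complex.ofReal_pow]
    rfl
  rw [← Complex.ofReal_inj, hn, assignmentState, ho.inner_sum]
  simp only [Complex.conj_ofReal, ← Complex.ofReal_mul, ← Complex.ofReal_sum]
  have : ∀ a, ((if F.Sat a then u.1 else u.2) * if F.Sat a then u.1 else u.2) =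
      if F.Sat a then u.1 ^ 2 else u.2 ^ 2 := fun a => by split_ifs <;> ring
  simp only [this]
  rw [sum_sat_ite]
  simp [amplitudeMass]

lemma projectBit_assignmentState_self (u : ℝ × ℝ) (k : Fin 2) :
    projectBit .control k (assignmentState F u k) = assignmentState F u k := by
  ext b
  simp only [projectBit]
  split_ifs with h
  · rfl
  · simp only [assignmentState, WithLp.ofLp_sum, Finset.sum_apply, PiLp.smul_apply, ket_apply]
    rw [Finset.sum_eq_zero]
    intro a _
    have : b ≠ encodeBits F a k := by rintro rfl; exact h rfl
    rw [if_neg this, smul_zero]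

lemma projectBit_assignmentState_of_ne (u : ℝ × ℝ) {k l : Fin 2} (hkl : k ≠ l) :
    projectBit .control k (assignmentState F u l) = 0 := by
  ext b
  simp only [projectBit]
  split_ifs with h
  · simp only [assignmentState, WithLp.ofLp_sum, Finset.sum_apply, PiLp.smul_apply, ket_apply]
    rw [Finset.sum_eq_zero]
    · rfl
    intro a _
    have : b ≠ encodeBits F a l := by rintro rfl; exact hkl h.symm
    rw [if_neg this, smul_zero]
  · rfl

lemma oracle_assignmentState (e : F.Numbering) (φ : ℝ) (u : ℝ × ℝ) :
    runCircuit (oracle e φ) (assignmentState F u 1) =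
      assignmentState F (-(Real.sin φ * u.1), 0) 0 +
        assignmentState F (-(Real.cos φ * u.1), u.2) 1 := by
  simp only [assignmentState, runCircuit_sum, runCircuit_smul, oracle_run]
  rw [← Finset.sum_add_distrib]
  refine Finset.sum_congr rfl fun a _ => ?_
  by_cases h : F.Sat a
  · simp only [if_pos h]
    push_cast
    module
  · simp only [if_neg h]
    push_cast
    module

lemma diffuser_assignmentState_zero (u : ℝ × ℝ) :
    runCircuit (diffuser F) (assignmentState F u 0) = assignmentState F u 0 := by
  simp only [assignmentState, runCircuit_sum, runCircuit_smul, diffuser_run_zero]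

lemma diffuser_assignmentState_one (u : ℝ × ℝ) :
    runCircuit (diffuser F) (assignmentState F u 1) =
      assignmentState F (u.1 - 2 / 2 ^ n * (F.solutions.card * u.1 + F.falsifyingCount * u.2),
        u.2 - 2 / 2 ^ n * (F.solutions.card * u.1 + F.falsifyingCount * u.2)) 1 := by
  set m : ℝ := F.solutions.card * u.1 + F.falsifyingCount * u.2 with hm
  have hsum : ∑ a, ((if F.Sat a then u.1 else u.2 : ℝ) : ℂ) = (m : ℂ) := by
    rw [← Complex.ofReal_sum, sum_sat_ite, nsmul_eq_mul, nsmul_eq_mul]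
  simp only [assignmentState, runCircuit_sum, runCircuit_smul, diffuser_run_one, smul_sub,
    Finset.sum_sub_distrib]
  rw [← Finset.sum_smul, hsum, smul_smul, Finset.smul_sum, ← Finset.sum_sub_distrib]
  refine Finset.sum_congr rfl fun a _ => ?_
  rw [← sub_smul]
  congr 1
  split_ifs <;> push_cast <;> ring

lemma iterate_assignmentState (e : F.Numbering) (φ : ℝ) (u : ℝ × ℝ) :
    iterate e φ (assignmentState F u 1) = assignmentState F (-(Real.sin φ * u.1), 0) 0 +
      assignmentState F
        (amplitudeStep F.solutions.card F.falsifyingCount (Real.cos φ) u) 1 := by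
  rw [iterate, oracle_assignmentState, runCircuit_add, diffuser_assignmentState_zero,
    diffuser_assignmentState_one, amplitudeStep, solutions_card_add_cast]
  simp only [mul_neg]

lemma iterate_smul (e : F.Numbering) (φ : ℝ) (z : ℂ) (ψ : QState F.Wire) :
    iterate e φ (z • ψ) = z • iterate e φ ψ := by
  simp only [iterate, runCircuit_smul]

/-- The amplitudes of the unnormalised state after `t` continuing iterations. -/
def amplitudes (F : CNF n) (φ : ℕ → ℝ) : ℕ → ℝ × ℝ
  | 0 => ((1 / √2) ^ n, (1 / √2) ^ n)
  | t + 1 => amplitudeStep F.solutions.card F.falsifyingCount (Real.cos (φ (t + 1)))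
      (amplitudes F φ t)

/-- The squared norm of the unnormalised state after `t` continuing iterations. -/
abbrev mass (F : CNF n) (φ : ℕ → ℝ) (t : ℕ) : ℝ :=
  amplitudeMass F.solutions.card F.falsifyingCount (amplitudes F φ t)

lemma mass_nonneg (φ : ℕ → ℝ) (t : ℕ) : 0 ≤ mass F φ t :=
  amplitudeMass_nonneg (by positivity) (by positivity) _

lemma mass_zero (φ : ℕ → ℝ) : mass F φ 0 = 1 := by
  simp only [mass, amplitudes, amplitudeMass]
  rw [← add_mul, solutions_card_add_cast, ← pow_mul, mul_comm n, pow_mul, ← mul_pow, div_pow,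
    Real.sq_sqrt (by norm_num)]
  norm_num

lemma mass_sub_mass_succ (φ : ℕ → ℝ) (t : ℕ) : mass F φ t - mass F φ (t + 1) =
    F.solutions.card * (Real.sin (φ (t + 1)) * (amplitudes F φ t).1) ^ 2 := by
  have h : (F.solutions.card : ℝ) + F.falsifyingCount ≠ 0 := by
    rw [solutions_card_add_cast]; positivity
  simp only [mass, amplitudes]
  rw [amplitudeMass_step h, amplitudeMass, mul_pow, Real.sin_sq]
  ring

lemma mass_succ_le (φ : ℕ → ℝ) (t : ℕ) : mass F φ (t + 1) ≤ mass F φ t := by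
  rw [← sub_nonneg, mass_sub_mass_succ]
  positivity

lemma initState_eq (F : CNF n) (φ : ℕ → ℝ) :
    initState F = assignmentState F (amplitudes F φ 0) 1 := by
  have h : assignmentState F (amplitudes F φ 0) 1 =
      (((1 / √2 : ℝ) : ℂ) ^ n) • ∑ a, ket (encodeBits F a 1) := by
    simp [assignmentState, amplitudes, Finset.smul_sum]
  rw [h]
  ext b
  simp only [initState, PiLp.smul_apply, WithLp.ofLp_sum, Finset.sum_apply, ket_apply, smul_eq_mul]
  have hb : ∀ a, b = encodeBits F a 1 ↔ (a = fun j => b (F.zeroth j)) ∧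
      ((∀ j i, b (.var j i) = b (F.zeroth j)) ∧
        (∀ i, b (.clause i) = 0) ∧ b .formula = 0 ∧ b .control = 1) := by
    intro a
    constructor
    · rintro rfl
      exact ⟨rfl, fun _ _ => rfl, fun _ => rfl, rfl, rfl⟩
    · rintro ⟨rfl, h1, h2, h3, h4⟩
      funext w
      cases w
      · exact h1 _ _
      · exact h2 _
      · exact h3
      · exact h4
  rw [Finset.prod_ite_zero, Finset.sum_eq_single fun j => b (F.zeroth j)]
  · simp only [hb, true_and, Finset.mem_univ, forall_true_left]
    by_cases h1 : ∀ j i, b (.var j i) = b (F.zeroth j) <;> simp [h1]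
  · intro a _ ha
    rw [if_neg fun h => ha ((hb a).1 h).1]
  · simp

/-! ### Closed forms for the run, its probabilities and its output -/

variable (e : F.Numbering) (φ : ℕ → ℝ) (t : ℕ)

lemma project_one_iterate (z : ℂ) (u : ℝ × ℝ) (θ : ℝ) :
    projectBit .control 1 (iterate e θ (z • assignmentState F u 1)) = z • assignmentState F
        (amplitudeStep F.solutions.card F.falsifyingCount (Real.cos θ) u) 1 := by
  rw [iterate_smul, iterate_assignmentState, projectBit_smul, projectBit_add,
    projectBit_assignmentState_of_ne _ (by decide), zero_add, projectBit_assignmentState_self]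

lemma project_zero_iterate (z : ℂ) (u : ℝ × ℝ) (θ : ℝ) :
    projectBit .control 0 (iterate e θ (z • assignmentState F u 1)) =
      z • assignmentState F (-(Real.sin θ * u.1), 0) 0 := by
  rw [iterate_smul, iterate_assignmentState, projectBit_smul, projectBit_add,
    projectBit_assignmentState_of_ne _ (show (0 : Fin 2) ≠ 1 by decide), add_zero,
    projectBit_assignmentState_self]

lemma norm_assignmentState_amplitudes :
    ‖assignmentState F (amplitudes F φ t) 1‖ = √(mass F φ t) := by
  rw [mass, ← norm_assignmentState_sq _ 1, Real.sqrt_sq (norm_nonneg _)]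

/-- The normalisations of successive measurements telescope into a single one. -/
lemma runState_eq : runState e φ t =
    (((√(mass F φ t))⁻¹ : ℝ) : ℂ) • assignmentState F (amplitudes F φ t) 1 := by
  induction t with
  | zero => rw [mass_zero, runState, initState_eq F φ]; simp
  | succ t ih =>
    rw [runState, measurePost, ih, project_one_iterate, ← amplitudes]
    rw [norm_smul, norm_assignmentState_amplitudes, Complex.norm_real,
      Real.norm_of_nonneg (by positivity),
      smul_smul, ← Complex.ofReal_mul]
    -- Once the mass vanishes it stays zero, and the convention `0⁻¹ = 0` makes both sides the zero
    -- vector.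
    by_cases h : mass F φ t = 0
    · have h' : mass F φ (t + 1) = 0 :=
        le_antisymm (h ▸ mass_succ_le φ t) (mass_nonneg φ _)
      simp [h, h']
    · have : √(mass F φ t) ≠ 0 := (Real.sqrt_ne_zero (mass_nonneg φ t)).2 h
      congr 2
      field_simp

lemma continueProb_eq : continueProb e φ t = mass F φ t := by
  induction t with
  | zero => rw [mass_zero, continueProb]
  | succ t ih =>
    rw [continueProb, ih, measureProb, runState_eq, project_one_iterate, ← amplitudes]
    rw [norm_smul, mul_pow, norm_assignmentState_sq, Complex.norm_real, Real.norm_eq_abs, sq_abs,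
      inv_pow, Real.sq_sqrt (mass_nonneg φ t)]
    by_cases h : mass F φ t = 0
    · have h' : mass F φ (t + 1) = 0 :=
        le_antisymm (h ▸ mass_succ_le φ t) (mass_nonneg φ _)
      rw [h, h', zero_mul]
    · rw [mul_inv_cancel_left₀ h]

lemma haltProb_eq : haltProb e φ t = mass F φ t - mass F φ (t + 1) := by
  rw [haltProb, continueProb_eq, measureProb, runState_eq, project_zero_iterate, norm_smul,
    mul_pow, norm_assignmentState_sq, Complex.norm_real, Real.norm_eq_abs, sq_abs, inv_pow,
    Real.sq_sqrt (mass_nonneg φ t)]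
  have h1 : amplitudeMass F.solutions.card F.falsifyingCount
      (-(Real.sin (φ (t + 1)) * (amplitudes F φ t).1), 0) = mass F φ t - mass F φ (t + 1) := by
    rw [mass_sub_mass_succ, amplitudeMass]
    ring
  rw [h1]
  by_cases h : mass F φ t = 0
  · have h' : mass F φ (t + 1) = 0 :=
      le_antisymm (h ▸ mass_succ_le φ t) (mass_nonneg φ _)
    rw [h, h', zero_mul, sub_zero]
  · rw [mul_inv_cancel_left₀ h]

lemma targetState_eq (F : CNF n) :
    F.targetState = assignmentState F (1 / √(F.solutions.card : ℝ), 0) 0 := by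
  rw [targetState, assignmentState, solutions, Finset.sum_filter, Finset.smul_sum]
  refine Finset.sum_congr rfl fun a _ => ?_
  have : encodeBits F a 0 = F.encode a := by funext w; cases w <;> rfl
  by_cases h : F.Sat a
  · simp only [if_pos h, this]; rfl
  · simp [if_neg h]

lemma norm_targetState (h : 0 < F.solutions.card) : ‖F.targetState‖ = 1 := by
  rw [← sq_eq_sq₀ (norm_nonneg _) zero_le_one, targetState_eq, norm_assignmentState_sq,
    amplitudeMass]
  have : (0 : ℝ) < F.solutions.card := by exact_mod_cast h
  rw [div_pow, Real.sq_sqrt this.le]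
  field_simp
  simp

lemma assignmentState_eq_smul_targetState (h : 0 < F.solutions.card) (x : ℝ) :
    assignmentState F (x, 0) 0 = ((x * √(F.solutions.card : ℝ) : ℝ) : ℂ) • F.targetState := by
  have h0 : √(F.solutions.card : ℝ) ≠ 0 := by positivity
  rw [targetState_eq, assignmentState, assignmentState, Finset.smul_sum]
  refine Finset.sum_congr rfl fun a _ => ?_
  rw [smul_smul, ← Complex.ofReal_mul]
  congr 2
  split_ifs
  · field_simp
  · simp

/-- The output is a multiple of the target; positive halting probability makes it a unit vector, so
the factor is a phase. -/
lemma outState_eq_smul (h : 0 < F.solutions.card) (ht : haltProb e φ t ≠ 0) :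
    ∃ z : ℂ, ‖z‖ = 1 ∧ outState e φ t = z • F.targetState := by
  have hn : ‖outState e φ t‖ = 1 := norm_measurePost _ _ _ (right_ne_zero_of_mul ht)
  obtain ⟨z, hz⟩ : ∃ z : ℂ, outState e φ t = z • F.targetState := by
    rw [outState, measurePost, runState_eq, project_zero_iterate,
      assignmentState_eq_smul_targetState h, smul_smul, smul_smul]
    exact ⟨_, rfl⟩
  refine ⟨z, ?_, hz⟩
  rwa [hz, norm_smul, norm_targetState h, mul_one] at hn

lemma sum_haltProb (T : ℕ) : ∑ t ∈ Finset.range T, haltProb e φ t = 1 - mass F φ T := by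
  simp only [haltProb_eq]
  rw [Finset.sum_range_sub', mass_zero]

end CNF

end

theorem theorem1 {n : ℕ} (F : CNF n) (hF : ∃ a : Fin n → Fin 2, F.Sat a) (e : F.Numbering)
    (φ : ℕ → ℝ)
    (hφ : ∀ t : ℕ, 2 ≤ t → Real.cos (φ t) =
      (1 - Real.sin (Real.pi / (2 * (t : ℝ)))) / (1 + Real.sin (Real.pi / (2 * (t : ℝ))))) :
    (∀ t : ℕ, CNF.haltProb e φ t ≠ 0 →
      ∃ z : ℂ, ‖z‖ = 1 ∧ CNF.outState e φ t = z • F.targetState) ∧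
    Tendsto (fun T : ℕ => ∑ t ∈ Finset.range T, CNF.haltProb e φ t) atTop (𝓝 1) := by
  have hM : 0 < F.solutions.card := by
    obtain ⟨a, ha⟩ := hF
    exact Finset.card_pos.2 ⟨a, Finset.mem_filter.2 ⟨Finset.mem_univ a, ha⟩⟩
  refine ⟨fun t ht => CNF.outState_eq_smul e φ t hM ht, ?_⟩
  have h : Tendsto (fun t => CNF.mass F φ t) atTop (𝓝 0) := by
    -- Step `t` of the recursion is iteration `t + 1`, so the free angle `φ 1` becomes the
    -- unconstrained cosine at index `0`.
    refine amplitudeMass_tendsto_zero hM (fun t => Real.cos (φ (t + 1)))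
      (fun t => Real.abs_cos_le_one _) (fun t ht => ?_) _ fun t => rfl
    have := inv_le_one_sub_sq_of_rule (t := t + 1) (by omega) (hφ (t + 1) (by omega))
    push_cast at this
    exact this
  simpa [CNF.sum_haltProb] using h.const_sub 1
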